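/- For real $p,r$ let $A_0(p,r)=1$ and $A_k(p,r)=\frac{r}{k!}\prod_{i=1}^{k-1}(kp+r-i)$ for $k\ge 1$ be the Fuss-Catalan (Raney) numbers. A measure $\nu$ on $\mathbb{R}$ is called unimodal if there are $a\in\mathbb{R}$, $c\ge 0$ and a function $f\ge 0$, non-decreasing on $(-\infty,a)$ and non-increasing on $(a,\infty)$, such that $\nu(\mathrm{d}x)=c\,\delta_a+f(x)\,\mathrm{d}x$. Let $r\ge 1$ be real. There is exactly one probability measure $\mu(2r,r)$ on $\mathbb{R}$ (the Fuss-Catalan distribution) that has finite moments of all orders with $\int_{\mathbb{R}} x^k\,\mu(2r,r)(\mathrm{d}x)=A_k(2r,r)$ for all $k\ge 0$, and $\mu(2r,r)$ is unimodal. Moreover, put $$\rho(\varphi)=\frac{\sin(2r\varphi)^{2r}}{\sin(\varphi)\,\sin((2r-1)\varphi)^{2r-1}},\qquad 0<\varphi<\frac{\pi}{2r}.$$ Then $\mu(2r,r)$ is absolutely continuous with respect to Lebesgue measure, with a Borel measurable density $W_{2r,r}\ge 0$ that vanishes outside $\rho\big((0,\pi/(2r))\big)$ and satisfies $$W_{2r,r}(\rho(\varphi))=\frac{\sin((2r-1)\varphi)^{r-1}\,\sin(\varphi)\,\sin(r\varphi)}{\pi\,\sin(2r\varphi)^{r}},\qquad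 0<\varphi<\frac{\pi}{2r},$$ and the function $\varphi\mapsto W_{2r,r}(\rho(\varphi))$ is non-decreasing on $(0,\pi/(2r))$. -/

import Mathlib

open MeasureTheory Set
open scoped NNReal ENNReal

noncomputable section

/-- The two-parameter Fuss-Catalan (Raney) numbers: `A₀(p, r) = 1` and
`A_k(p, r) = (r / k!) * ∏_{i=1}^{k-1} (k p + r - i)` for `k ≥ 1`. -/
def fussCatalanNumber (p r : ℝ) : ℕ → ℝ
  | 0 => 1
  | k + 1 =>
      r / ((k + 1).factorial : ℝ) * ∏ i ∈ Finset.Icc 1 k, (((k + 1 : ℕ) : ℝ) * p + r - (i : ℝ))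

/-- `μ` is a Fuss-Catalan distribution with parameters `p, r`: a probability measure on `ℝ` that
has moments of all orders, the `k`-th one being `A_k(p, r)`. -/
structure IsFussCatalanDistribution (p r : ℝ) (μ : Measure ℝ) : Prop where
  isProbabilityMeasure : IsProbabilityMeasure μ
  integrable_pow : ∀ k : ℕ, Integrable (fun x : ℝ => x ^ k) μ
  integral_pow : ∀ k : ℕ, ∫ x, x ^ k ∂μ = fussCatalanNumber p r k

/-- `ν` is unimodal with mode `a`: `ν(dx) = c δ_a + f(x) dx`, where `c ≥ 0` and `f ≥ 0` is
non-decreasing on `(-∞, a)` and non-increasing on `(a, ∞)`. -/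
def IsUnimodalWithMode (ν : Measure ℝ) (a : ℝ) : Prop :=
  ∃ (c : ℝ≥0) (f : ℝ → ℝ), (∀ x, 0 ≤ f x) ∧ MonotoneOn f (Iio a) ∧ AntitoneOn f (Ioi a) ∧
    ν = (c : ℝ≥0∞) • Measure.dirac a + volume.withDensity (fun x => ENNReal.ofReal (f x))

/-- `ν` is unimodal (with some mode). -/
def IsUnimodal (ν : Measure ℝ) : Prop :=
  ∃ a : ℝ, IsUnimodalWithMode ν a

/-- The parametrization `ρ(φ) = sin(pφ)^p / (sin φ * sin((p-1)φ)^(p-1))`, for `0 < φ < π / p`. -/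
def fussCatalanParam (p φ : ℝ) : ℝ :=
  Real.sin (p * φ) ^ p / (Real.sin φ * Real.sin ((p - 1) * φ) ^ (p - 1))

end

open Filter Topology

/-! Put `p = 2r`. The moments of the explicit density are computed by a contour integral. Let `B(φ)`
be the point of argument `φ` for which `B - 1` has argument `pφ` (`fussCatalanCurve`). Then `B ^ p /
(B - 1)` is the real number `ρ(φ)`, so `-ρ'/ρ = (1 / (B - 1) - p / B) B'`
(`deriv_fussCatalanCurve_mul`), while `ρ W(ρ) = Im (B ^ r) / π`
(`fussCatalanParam_mul_angularDensity`). Substituting `x = ρ(φ)`, `π` times the `k`-th moment of `W`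
becomes the imaginary part of the integral of `z ^ (pk + r) / (z - 1) ^ k * (1 / (z - 1) - p / z)`
along `B`, which runs in the upper half-plane from `p / (p - 1) > 1` to `0`.

Passing over the pole at `1` contributes `π` times the residue there, a combination of Taylor
coefficients of powers of `z` at `1`, that is, of binomial coefficients; it equals `A_k(p, r)`. In
place of a residue theorem, explicit primitives are followed to both endpoints
(`exists_primitive_fussCatalan`). The disc `|z - 2| < 2` contains `1` and `p / (p - 1)`, has `0` on
its boundary, and lies in the right half-plane, where principal powers are holomorphic.

Uniqueness holds because `ρ` is bounded: the even moments grow geometrically, so they determine the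
complex moment generating function. Finally `ρ` decreases and `W(ρ(φ))` increases in `φ`, so `W`
decreases on `(0, ∞)` and `0` is a mode. -/

/-! ### Moment determinacy -/

/-- The complex moment generating function of a measure whose even moments grow at most
geometrically is the exponential generating series of the moments. -/
theorem complexMGF_hasSum_of_moment_le {μ : Measure ℝ} [IsProbabilityMeasure μ]
    (hint : ∀ k : ℕ, Integrable (fun x : ℝ => x ^ k) μ) {C : ℝ} (hC : 0 < C)
    (hb : ∀ k : ℕ, ∫ x, x ^ (2 * k) ∂μ ≤ C ^ (2 * k)) (z : ℂ) :
    HasSum (fun k : ℕ => z ^ k / (k.factorial : ℂ) * ((∫ x, x ^ k ∂μ : ℝ) : ℂ))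
      (ProbabilityTheory.complexMGF id μ z) := by
  have habs : ∀ k : ℕ, ∫ x, |x| ^ k ∂μ ≤ C ^ k := by
    intro k
    -- AM-GM bounds every absolute moment by an even one, so the series may be integrated termwise.
    have h1 : ∀ x : ℝ, |x| ^ k ≤ (C ^ k + x ^ (2 * k) / C ^ k) / 2 := by
      intro x
      have hCk : 0 < C ^ k := pow_pos hC k
      have hx : x ^ (2 * k) = (|x| ^ k) ^ 2 := by
        rw [pow_mul, ← sq_abs, ← pow_mul, ← pow_mul, mul_comm]
      rw [hx, le_div_iff₀ two_pos, ← sub_nonneg]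
      have : C ^ k + (|x| ^ k) ^ 2 / C ^ k - |x| ^ k * 2 = (C ^ k - |x| ^ k) ^ 2 / C ^ k := by
        field_simp; ring
      rw [this]; positivity
    have hint2 : Integrable (fun x : ℝ => (C ^ k + x ^ (2 * k) / C ^ k) / 2) μ :=
      ((integrable_const _).add ((hint (2 * k)).div_const _)).div_const _
    have hint1 : Integrable (fun x : ℝ => |x| ^ k) μ := by
      simpa [Real.norm_eq_abs, abs_pow] using (hint k).norm
    calc ∫ x, |x| ^ k ∂μ ≤ ∫ x, (C ^ k + x ^ (2 * k) / C ^ k) / 2 ∂μ :=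
          integral_mono hint1 hint2 h1
      _ = (C ^ k + (∫ x, x ^ (2 * k) ∂μ) / C ^ k) / 2 := by
          rw [integral_div, integral_add (integrable_const _) ((hint (2 * k)).div_const _),
            integral_div]
          simp
      _ ≤ (C ^ k + C ^ (2 * k) / C ^ k) / 2 := by
          gcongr; exact hb k
      _ = C ^ k := by
          rw [two_mul, pow_add]; field_simp; ring
  set F : ℕ → ℝ → ℂ := fun k x => z ^ k / (k.factorial : ℂ) * ((x ^ k : ℝ) : ℂ) with hF
  have hFint : ∀ k, Integrable (F k) μ := fun k => ((hint k).ofReal).const_mul _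
  have hnorm : ∀ k, ∫ x, ‖F k x‖ ∂μ ≤ (‖z‖ * C) ^ k / (k.factorial : ℝ) := by
    intro k
    have : ∀ x, ‖F k x‖ = ‖z‖ ^ k / (k.factorial : ℝ) * |x| ^ k := by
      intro x; simp [hF]
    simp_rw [this]
    rw [integral_const_mul, mul_pow, mul_div_right_comm]
    gcongr
    exact habs k
  have hsum : Summable fun k => ∫ x, ‖F k x‖ ∂μ :=
    Summable.of_nonneg_of_le (fun k => integral_nonneg fun x => norm_nonneg _) hnorm
      (Real.summable_pow_div_factorial _)
  have key := hasSum_integral_of_summable_integral_norm hFint hsum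
  have hexp : ∀ x : ℝ, ∑' k, F k x = Complex.exp (z * x) := by
    intro x
    rw [Complex.exp_eq_exp_ℂ, NormedSpace.exp_eq_tsum_div]
    refine tsum_congr fun k => ?_
    simp [hF, mul_pow]; ring
  simp_rw [hexp] at key
  have hk : ∀ k, ∫ x, F k x ∂μ = z ^ k / (k.factorial : ℂ) * ((∫ x, x ^ k ∂μ : ℝ) : ℂ) := by
    intro k
    rw [hF, integral_const_mul]
    exact congrArg _ integral_ofReal
  simp_rw [hk] at key
  exact key

/-- A probability measure whose even moments grow at most geometrically is determined by its
moments. -/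
theorem measure_eq_of_moments_eq {μ ν : Measure ℝ} [IsProbabilityMeasure μ]
    [IsProbabilityMeasure ν] (hμ : ∀ k : ℕ, Integrable (fun x : ℝ => x ^ k) μ)
    (hν : ∀ k : ℕ, Integrable (fun x : ℝ => x ^ k) ν)
    (h : ∀ k : ℕ, ∫ x, x ^ k ∂μ = ∫ x, x ^ k ∂ν) {C : ℝ} (hC : 0 < C)
    (hb : ∀ k : ℕ, ∫ x, x ^ (2 * k) ∂ν ≤ C ^ (2 * k)) : μ = ν := by
  apply Measure.ext_of_complexMGF_id_eq
  funext z
  have h1 := complexMGF_hasSum_of_moment_le hμ hC (fun k => (h _).trans_le (hb k)) z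
  have h2 := complexMGF_hasSum_of_moment_le hν hC hb z
  simp_rw [h] at h1
  exact h1.unique h2

/-! ### Primitives on the upper half-disc -/

/-- The part of the disc `|z - 2| < 2` in the upper half-plane. -/
def upperHalfDisc : Set ℂ := {z | 0 < z.im} ∩ Metric.ball 2 2

theorem re_pos_of_mem_ball_two {z : ℂ} (hz : z ∈ Metric.ball (2 : ℂ) 2) : 0 < z.re := by
  rw [Metric.mem_ball, Complex.dist_eq] at hz
  have h := (abs_lt.1 ((Complex.abs_re_le_norm (z - 2)).trans_lt hz)).1
  simp at h
  exact h

theorem ofReal_mem_ball_two {x : ℝ} (h0 : 0 < x) (h4 : x < 4) :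
    (x : ℂ) ∈ Metric.ball (2 : ℂ) 2 := by
  rw [Metric.mem_ball, Complex.dist_eq]
  have : ((x : ℂ) - 2) = ((x - 2 : ℝ) : ℂ) := by push_cast; rfl
  rw [this, Complex.norm_real, Real.norm_eq_abs, abs_lt]
  constructor <;> linarith

theorem hasDerivAt_cpow_ofReal {z : ℂ} (hz : 0 < z.re) (a : ℝ) :
    HasDerivAt (fun z : ℂ => z ^ (a : ℂ)) (a * z ^ ((a - 1 : ℝ) : ℂ)) z := by
  have := (hasDerivAt_id z).cpow_const (c := (a : ℂ)) (Or.inl hz)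
  simpa using this

theorem im_dslope_cpow_ofReal (a : ℝ) {x : ℝ} (hx : 0 < x) :
    (dslope (fun z : ℂ => z ^ (a : ℂ)) 1 (x : ℂ)).im = 0 := by
  by_cases h : (x : ℂ) = 1
  · rw [h, dslope_same, (hasDerivAt_cpow_ofReal (by simp) a).deriv]
    simp
  · rw [dslope_of_ne _ h, slope_def_field, ← Complex.ofReal_cpow hx.le]
    have : ((x ^ a : ℝ) : ℂ) - 1 ^ (a : ℂ) = ((x ^ a - 1 : ℝ) : ℂ) := by simp
    rw [this]
    have : (x : ℂ) - 1 = ((x - 1 : ℝ) : ℂ) := by simp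
    rw [this, ← Complex.ofReal_div, Complex.ofReal_im]

/-- Near the origin the denominator is at least `1/2` and the numerator at most `2`. This makes the
primitive below Lipschitz up to the boundary point `0`. -/
theorem norm_dslope_cpow_le {a : ℝ} (ha : 0 ≤ a) {z : ℂ} (hz : ‖z‖ < 1 / 2) :
    ‖dslope (fun z : ℂ => z ^ (a : ℂ)) 1 z‖ ≤ 4 := by
  have h1 : 1 / 2 ≤ ‖z - 1‖ := by
    have := norm_sub_norm_le (1 : ℂ) z
    rw [norm_sub_rev] at this
    simp at this
    linarith
  have hne : z ≠ 1 := by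
    rintro rfl
    norm_num at hz
  rw [dslope_of_ne _ hne, slope_def_field, norm_div, div_le_iff₀ (by linarith)]
  calc ‖z ^ (a : ℂ) - 1 ^ (a : ℂ)‖ ≤ ‖z ^ (a : ℂ)‖ + ‖(1 : ℂ) ^ (a : ℂ)‖ := norm_sub_le _ _
    _ ≤ 1 + 1 := by
        gcongr
        · rw [Complex.norm_cpow_real]
          exact Real.rpow_le_one (norm_nonneg _) (by linarith) ha
        · simp
    _ ≤ 4 * ‖z - 1‖ := by linarith

/-- The difference quotient of `z ↦ z ^ a` at `1` has a primitive on the disc `|z - 2| < 2` whose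
imaginary part vanishes on the real axis and tends to zero at the origin. -/
theorem exists_primitive_dslope_cpow {a : ℝ} (ha : 0 ≤ a) :
    ∃ G : ℂ → ℂ, (∀ z ∈ Metric.ball (2 : ℂ) 2,
        HasDerivAt G (dslope (fun z : ℂ => z ^ (a : ℂ)) 1 z) z) ∧
      (∀ x : ℝ, 0 < x → x < 4 → (G x).im = 0) ∧
      Tendsto (fun z => (G z).im) (𝓝[Metric.ball 2 2] 0) (𝓝 0) := by
  have hd : DifferentiableOn ℂ (dslope (fun z : ℂ => z ^ (a : ℂ)) 1) (Metric.ball 2 2) := by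
    rw [Complex.differentiableOn_dslope (Metric.isOpen_ball.mem_nhds
      (by simpa using ofReal_mem_ball_two one_pos (by norm_num)))]
    exact fun z hz => (hasDerivAt_cpow_ofReal
      (re_pos_of_mem_ball_two hz) a).differentiableAt.differentiableWithinAt
  -- The normalization `G 1 = 0` makes `G` real on the real segment.
  obtain ⟨G, hG1, hG⟩ := hd.isExactOn_ball.with_val_at 1 0
  have him : ∀ x : ℝ, 0 < x → x < 4 → (G x).im = 0 := by
    have hder : ∀ x ∈ Ioo (0 : ℝ) 4, HasDerivAt (fun x : ℝ => (G x).im) 0 x := by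
      intro x hx
      have h1 := (hG x (ofReal_mem_ball_two hx.1 hx.2)).comp_ofReal
      have h2 := (Complex.imCLM.hasFDerivAt.comp_hasDerivAt x h1)
      simpa [Function.comp_def, im_dslope_cpow_ofReal a hx.1] using h2
    intro x h0 h4
    have := (convex_Ioo (0 : ℝ) 4).is_const_of_fderivWithin_eq_zero (𝕜 := ℝ)
      (f := fun x : ℝ => (G x).im)
      (fun y hy => (hder y hy).differentiableAt.differentiableWithinAt)
      (fun y hy => by
        rw [fderivWithin_of_isOpen isOpen_Ioo hy]
        ext; simp [(hder y hy).deriv]) (x := x) (y := 1) ⟨h0, h4⟩ (by norm_num)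
    simpa [hG1] using this
  refine ⟨G, hG, him, ?_⟩
  -- Compare `z` with the real point `‖z‖`, where `G` has zero imaginary part, by the Lipschitz
  -- bound.
  have hbound : ∀ᶠ z : ℂ in 𝓝[Metric.ball 2 2] 0, ‖(G z).im‖ ≤ 4 * ‖z - (‖z‖ : ℂ)‖ := by
    have hsmall : ∀ᶠ z : ℂ in 𝓝[Metric.ball 2 2] 0, z ∈ Metric.ball (0 : ℂ) (1 / 2) :=
      mem_nhdsWithin_of_mem_nhds (Metric.ball_mem_nhds _ (by norm_num))
    filter_upwards [hsmall, self_mem_nhdsWithin] with z hz hz2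
    have hz' : ‖z‖ < 1 / 2 := by simpa using hz
    have hz0 : 0 < ‖z‖ := by
      rw [norm_pos_iff]
      rintro rfl
      simpa using re_pos_of_mem_ball_two hz2
    have hconv : Convex ℝ (Metric.ball (2 : ℂ) 2 ∩ Metric.ball (0 : ℂ) (1 / 2)) :=
      (convex_ball _ _).inter (convex_ball _ _)
    have := hconv.norm_image_sub_le_of_norm_hasDerivWithin_le (f := G)
      (fun w hw => (hG w hw.1).hasDerivWithinAt)
      (fun w hw => norm_dslope_cpow_le ha (by simpa using hw.2))
      (x := (‖z‖ : ℂ)) (y := z)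
      ⟨ofReal_mem_ball_two hz0 (by linarith), by simpa using hz'⟩ ⟨hz2, hz⟩
    calc ‖(G z).im‖ = |(G z - G (‖z‖ : ℂ)).im| := by
          rw [Complex.sub_im, him _ hz0 (by linarith), sub_zero, Real.norm_eq_abs]
      _ ≤ ‖G z - G (‖z‖ : ℂ)‖ := Complex.abs_im_le_norm _
      _ ≤ _ := this
  refine squeeze_zero_norm' hbound ?_
  have : Continuous fun z : ℂ => 4 * ‖z - (‖z‖ : ℂ)‖ := by fun_prop
  simpa using (this.tendsto 0).mono_left nhdsWithin_le_nhds

theorem tendsto_cpow_upperHalfDisc_zero {a : ℝ} (ha : 0 < a) :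
    Tendsto (fun z : ℂ => z ^ (a : ℂ)) (𝓝[upperHalfDisc] 0) (𝓝 0) := by
  rw [tendsto_zero_iff_norm_tendsto_zero]
  simp_rw [Complex.norm_cpow_real]
  have : ContinuousAt (fun z : ℂ => ‖z‖ ^ a) 0 :=
    continuous_norm.continuousAt.rpow_const (Or.inr ha.le)
  have h := this.tendsto
  simp only [norm_zero, Real.zero_rpow ha.ne'] at h
  exact h.mono_left nhdsWithin_le_nhds

theorem im_cpow_div_ofReal (a : ℝ) (k : ℕ) {x : ℝ} (hx : 0 ≤ x) :
    ((x : ℂ) ^ (a : ℂ) / ((x : ℂ) - 1) ^ k).im = 0 := by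
  rw [← Complex.ofReal_cpow hx]
  have : ((x ^ a : ℝ) : ℂ) / ((x : ℂ) - 1) ^ k = ((x ^ a / (x - 1) ^ k : ℝ) : ℂ) := by push_cast; rfl
  rw [this, Complex.ofReal_im]

theorem tendsto_im_cpow_div_real (a : ℝ) (k : ℕ) {x : ℝ} (hx : 1 < x) :
    Tendsto (fun z : ℂ => (z ^ (a : ℂ) / (z - 1) ^ k).im) (𝓝[upperHalfDisc] x) (𝓝 0) := by
  have h1 : ContinuousAt (fun z : ℂ => z ^ (a : ℂ) / (z - 1) ^ k) x := by
    refine ContinuousAt.div (hasDerivAt_cpow_ofReal (by simp; linarith) a).continuousAt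
      (by fun_prop) (pow_ne_zero _ ?_)
    rw [sub_ne_zero]
    exact_mod_cast hx.ne'
  have h2 := (Complex.continuous_im.continuousAt.comp h1).tendsto
  simp only [Function.comp_def, im_cpow_div_ofReal a k (zero_le_one.trans hx.le)] at h2
  exact h2.mono_left nhdsWithin_le_nhds

theorem tendsto_im_cpow_div_zero {a : ℝ} (ha : 0 < a) (k : ℕ) :
    Tendsto (fun z : ℂ => (z ^ (a : ℂ) / (z - 1) ^ k).im) (𝓝[upperHalfDisc] 0) (𝓝 0) := by
  have h1 : Tendsto (fun z : ℂ => (z - 1) ^ k) (𝓝[upperHalfDisc] 0) (𝓝 ((0 - 1) ^ k)) := by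
    have : Continuous fun z : ℂ => (z - 1) ^ k := by fun_prop
    exact (this.tendsto 0).mono_left nhdsWithin_le_nhds
  have h2 := (tendsto_cpow_upperHalfDisc_zero ha).div h1 (pow_ne_zero _ (by norm_num))
  rw [zero_div] at h2
  have h3 := (Complex.continuous_im.tendsto 0).comp h2
  rw [Complex.zero_im] at h3
  exact h3

theorem ne_one_of_mem_upperHalfDisc {z : ℂ} (hz : z ∈ upperHalfDisc) : z - 1 ≠ 0 := by
  intro h
  have h1 : 0 < z.im := hz.1
  rw [sub_eq_zero.1 h] at h1
  simp at h1

/-- On the upper half-disc, `z ^ a / (z - 1) ^ (k + 1)` has a primitive whose imaginary part tends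
to `0` at the real points `x > 1` and to `π * (a choose k)` at the origin. -/
theorem exists_primitive_cpow_div_pow (k : ℕ) : ∀ a : ℝ, (k : ℝ) ≤ a →
    ∃ Q : ℂ → ℂ, (∀ z ∈ upperHalfDisc, HasDerivAt Q (z ^ (a : ℂ) / (z - 1) ^ (k + 1)) z) ∧
      (∀ x : ℝ, 1 < x → x < 4 → Tendsto (fun z => (Q z).im) (𝓝[upperHalfDisc] x) (𝓝 0)) ∧
      Tendsto (fun z => (Q z).im) (𝓝[upperHalfDisc] 0)
        (𝓝 (Real.pi * ((∏ i ∈ Finset.range k, (a - i)) / (k.factorial : ℝ)))) := by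
  induction k with
  | zero =>
    intro a ha
    obtain ⟨G, hG, hGim, hG0⟩ := exists_primitive_dslope_cpow (by simpa using ha : 0 ≤ a)
    refine ⟨fun z => G z + Complex.log (z - 1), fun z hz => ?_, fun x h1 h4 => ?_, ?_⟩
    · have hne := ne_one_of_mem_upperHalfDisc hz
      have hlog : HasDerivAt (fun z : ℂ => Complex.log (z - 1)) (1 / (z - 1)) z :=
        ((hasDerivAt_id z).sub_const 1).clog (Or.inr (by simpa using hz.1.ne'))
      refine ((hG z hz.2).add hlog).congr_deriv ?_
      rw [dslope_of_ne _ (sub_ne_zero.1 hne), slope_def_field]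
      simp only [Complex.one_cpow]
      field_simp
      ring
    · have hlog : ContinuousAt (fun z : ℂ => Complex.log (z - 1)) x :=
        ContinuousAt.clog (by fun_prop) (Or.inl (by simpa using h1))
      have hc := (hG x (ofReal_mem_ball_two (by linarith) h4)).continuousAt.add hlog
      have h : Tendsto (fun z : ℂ => (G z + Complex.log (z - 1)).im) (𝓝 (x : ℂ))
          (𝓝 (G x + Complex.log (x - 1)).im) :=
        (Complex.continuous_im.continuousAt.comp hc).tendsto
      have h0 : (Complex.log ((x : ℂ) - 1)).im = 0 := by
        have : (x : ℂ) - 1 = ((x - 1 : ℝ) : ℂ) := by push_cast; rfl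
        rw [this, Complex.log_im, Complex.arg_ofReal_of_nonneg (by linarith)]
      rw [Complex.add_im, hGim x (by linarith) h4, h0, add_zero] at h
      exact h.mono_left nhdsWithin_le_nhds
    -- The source of `π`: `z - 1` tends to `-1` from above the branch cut, where `arg` tends to `π`.
    · have harg := (Complex.continuousWithinAt_arg_of_re_neg_of_im_zero (z := -1)
        (by simp) (by simp)).tendsto
      rw [Complex.arg_neg_one] at harg
      have hmap : Tendsto (fun z : ℂ => z - 1) (𝓝[upperHalfDisc] 0)
          (𝓝[{z : ℂ | 0 ≤ z.im}] (-1)) := by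
        refine tendsto_nhdsWithin_iff.2 ⟨?_, ?_⟩
        · have : Continuous fun z : ℂ => z - 1 := by fun_prop
          simpa using (this.tendsto 0).mono_left nhdsWithin_le_nhds
        · filter_upwards [self_mem_nhdsWithin] with z hz
          simpa using hz.1.le
      have h1 := harg.comp hmap
      have h2 := (hG0.mono_left (nhdsWithin_mono _ (inter_subset_right
        (s := {z : ℂ | 0 < z.im})))).add h1
      simpa [Function.comp_def, Complex.log_im, upperHalfDisc] using h2
  | succ k ih =>
    intro a ha
    push_cast at ha
    have ha0 : 0 < a := by have := Nat.cast_nonneg (α := ℝ) k; linarith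
    obtain ⟨Q, hQ, hQx, hQ0⟩ := ih (a - 1) (by linarith)
    have hk : ((k : ℂ) + 1) ≠ 0 := by exact_mod_cast Nat.succ_ne_zero k
    have him : ∀ z : ℂ, (((a : ℂ) * Q z - z ^ (a : ℂ) / (z - 1) ^ (k + 1)) / ((k : ℂ) + 1)).im =
        (a * (Q z).im - (z ^ (a : ℂ) / (z - 1) ^ (k + 1)).im) / ((k : ℝ) + 1) := by
      intro z
      have : (k : ℂ) + 1 = ((k + 1 : ℝ) : ℂ) := by push_cast; rfl
      rw [this, Complex.div_ofReal_im, Complex.sub_im, Complex.im_ofReal_mul]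
    -- Integration by parts lowers both the exponent and the pole order by one; the boundary term
    -- has imaginary part tending to `0` at both kinds of endpoint.
    refine ⟨fun z => ((a : ℂ) * Q z - z ^ (a : ℂ) / (z - 1) ^ (k + 1)) / ((k : ℂ) + 1),
      fun z hz => ?_, fun x h1 h4 => ?_, ?_⟩
    · have hne := ne_one_of_mem_upperHalfDisc hz
      have hpow : HasDerivAt (fun z : ℂ => (z - 1) ^ (k + 1)) (((k + 1 : ℕ) : ℂ) * (z - 1) ^ k) z := by
        have := ((hasDerivAt_id z).sub_const (1 : ℂ)).pow (k + 1)
        simp only [Nat.add_sub_cancel, mul_one] at this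
        exact this
      have h1 := (hasDerivAt_cpow_ofReal (re_pos_of_mem_ball_two hz.2) a).div hpow
        (pow_ne_zero _ hne)
      refine ((((hQ z hz).const_mul (a : ℂ)).sub h1).div_const _).congr_deriv ?_
      push_cast
      field_simp
      ring
    · simp_rw [him]
      simpa using (((hQx x h1 h4).const_mul a).sub
        (tendsto_im_cpow_div_real a (k + 1) h1)).div_const ((k : ℝ) + 1)
    · simp_rw [him]
      have := ((hQ0.const_mul a).sub (tendsto_im_cpow_div_zero ha0 (k + 1))).div_const ((k : ℝ) + 1)
      convert this using 2
      rw [Finset.prod_range_succ', Nat.factorial_succ]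
      have : ∀ i ∈ Finset.range k, a - ((i + 1 : ℕ) : ℝ) = a - 1 - (i : ℝ) := by
        intro i _; push_cast; ring
      rw [Finset.prod_congr rfl this]
      push_cast
      field_simp
      ring

/-! ### Raney numbers as boundary values of a primitive -/

/-- With `n = k + 1` this is `C(pn + r, n) - p C(pn + r - 1, n - 1)`: after the common product is
factored out, `(pn + r) / n - p = r / n` remains. -/
theorem fussCatalanNumber_eq_choose_sub (p r : ℝ) (k : ℕ) :
    fussCatalanNumber p r (k + 1) =
      (∏ i ∈ Finset.range (k + 1), (p * (k + 1 : ℕ) + r - i)) / ((k + 1).factorial : ℝ) -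
        p * ((∏ i ∈ Finset.range k, (p * (k + 1 : ℕ) + r - 1 - i)) / (k.factorial : ℝ)) := by
  rw [fussCatalanNumber, Finset.prod_range_succ', Nat.factorial_succ]
  have h1 : ∏ i ∈ Finset.Icc 1 k, (((k + 1 : ℕ) : ℝ) * p + r - (i : ℝ)) =
      ∏ i ∈ Finset.range k, (p * (k + 1 : ℕ) + r - 1 - i) := by
    rw [← Finset.Ico_succ_right_eq_Icc, Finset.prod_Ico_eq_prod_range]
    refine Finset.prod_congr (by simp) fun i _ => ?_
    push_cast; ring
  have h2 : ∏ i ∈ Finset.range k, (p * (k + 1 : ℕ) + r - (i + 1 : ℕ)) =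
      ∏ i ∈ Finset.range k, (p * (k + 1 : ℕ) + r - 1 - i) := by
    refine Finset.prod_congr rfl fun i _ => ?_
    push_cast; ring
  rw [h1, h2]
  push_cast
  field_simp
  ring

/-- The integrand splits as `z ^ (pk + r) / (z - 1) ^ (k + 1)` minus `p z ^ (pk + r - 1) / (z - 1) ^
k`, which yield the two binomial coefficients of `fussCatalanNumber_eq_choose_sub`. -/
theorem exists_primitive_fussCatalan {p r : ℝ} (hp : 1 ≤ p) (hr : 0 < r) (k : ℕ) :
    ∃ H : ℂ → ℂ, (∀ z ∈ upperHalfDisc, HasDerivAt H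
        (z ^ ((p * k + r : ℝ) : ℂ) / (z - 1) ^ k * (1 / (z - 1) - p / z)) z) ∧
      (∀ x : ℝ, 1 < x → x < 4 → Tendsto (fun z => (H z).im) (𝓝[upperHalfDisc] x) (𝓝 0)) ∧
      Tendsto (fun z => (H z).im) (𝓝[upperHalfDisc] 0)
        (𝓝 (Real.pi * fussCatalanNumber p r k)) := by
  have hk0 := Nat.cast_nonneg (α := ℝ) k
  have hpk : (k : ℝ) ≤ p * k := le_mul_of_one_le_left hk0 hp
  obtain ⟨Q, hQ, hQx, hQ0⟩ := exists_primitive_cpow_div_pow k (p * k + r) (by linarith)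
  have hsplit : ∀ z : ℂ, z ∈ upperHalfDisc →
      z ^ ((p * k + r : ℝ) : ℂ) = z ^ ((p * k + r - 1 : ℝ) : ℂ) * z := by
    intro z hz
    have hz0 : z ≠ 0 := by
      rintro rfl
      simpa using re_pos_of_mem_ball_two hz.2
    have : ((p * k + r : ℝ) : ℂ) = ((p * k + r - 1 : ℝ) : ℂ) + 1 := by push_cast; ring
    rw [this, Complex.cpow_add _ _ hz0, Complex.cpow_one]
  cases k with
  | zero =>
    have hr' : (r : ℂ) ≠ 0 := by exact_mod_cast hr.ne'
    have him : ∀ z : ℂ, (Q z - p / r * (z ^ (r : ℂ) / (z - 1) ^ 0)).im =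
        (Q z).im - p / r * (z ^ (r : ℂ) / (z - 1) ^ 0).im := by
      intro z
      have : (p : ℂ) / r = ((p / r : ℝ) : ℂ) := by push_cast; rfl
      rw [this, Complex.sub_im, Complex.im_ofReal_mul]
    -- For `k = 0` the second term has no pole; its primitive `(p / r) z ^ r` tends to `0` at the
    -- origin because `r > 0`.
    refine ⟨fun z => Q z - p / r * (z ^ (r : ℂ) / (z - 1) ^ 0), fun z hz => ?_, fun x h1 h4 => ?_, ?_⟩
    · have hne := ne_one_of_mem_upperHalfDisc hz
      have hz0 : z ≠ 0 := by
        rintro rfl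
        simpa using re_pos_of_mem_ball_two hz.2
      have h1 := ((hasDerivAt_cpow_ofReal (re_pos_of_mem_ball_two hz.2) r).const_mul
        ((p : ℂ) / r))
      simp only [pow_zero, div_one]
      refine ((hQ z hz).sub h1).congr_deriv ?_
      rw [hsplit z hz]
      simp only [Nat.cast_zero, mul_zero, zero_add]
      field_simp
    · simp_rw [him]
      simpa using (hQx x h1 h4).sub ((tendsto_im_cpow_div_real r 0 h1).const_mul (p / r))
    · simp_rw [him]
      simpa [fussCatalanNumber] using hQ0.sub ((tendsto_im_cpow_div_zero hr 0).const_mul (p / r))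
  | succ k =>
    obtain ⟨P, hP, hPx, hP0⟩ := exists_primitive_cpow_div_pow k (p * (k + 1 : ℕ) + r - 1) (by
      push_cast at hpk ⊢; linarith)
    have him : ∀ z : ℂ, (Q z - p * P z).im = (Q z).im - p * (P z).im := by
      intro z
      rw [Complex.sub_im, Complex.im_ofReal_mul]
    refine ⟨fun z => Q z - p * P z, fun z hz => ?_, fun x h1 h4 => ?_, ?_⟩
    · have hne := ne_one_of_mem_upperHalfDisc hz
      have hz0 : z ≠ 0 := by
        rintro rfl
        simpa using re_pos_of_mem_ball_two hz.2
      refine ((hQ z hz).sub ((hP z hz).const_mul (p : ℂ))).congr_deriv ?_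
      rw [hsplit z hz]
      field_simp
      ring
    · simp_rw [him]
      simpa using (hQx x h1 h4).sub ((hPx x h1 h4).const_mul p)
    · simp_rw [him]
      rw [fussCatalanNumber_eq_choose_sub]
      convert hQ0.sub (hP0.const_mul p) using 2
      ring

/-! ### Calculus on an open interval -/

/-- Nonnegativity of the derivative gives integrability for free, so only the one-sided limits of
the primitive are needed. -/
theorem integral_Ioo_of_hasDerivAt_of_nonneg {f f' : ℝ → ℝ} {a b fa fb : ℝ} (hab : a < b)
    (hderiv : ∀ x ∈ Ioo a b, HasDerivAt f (f' x) x) (hpos : ∀ x ∈ Ioo a b, 0 ≤ f' x)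
    (ha : Tendsto f (𝓝[>] a) (𝓝 fa)) (hb : Tendsto f (𝓝[<] b) (𝓝 fb)) :
    IntegrableOn f' (Ioo a b) ∧ ∫ x in Ioo a b, f' x = fb - fa := by
  have hc : ContinuousOn f (Ioo a b) := fun x hx => (hderiv x hx).continuousAt.continuousWithinAt
  have hext := continuousOn_Icc_extendFrom_Ioo hc ha hb
  have hd : ∀ x ∈ Ioo a b, HasDerivAt (extendFrom (Ioo a b) f) (f' x) x := fun x hx =>
    (hderiv x hx).congr_of_eventuallyEq (by
      filter_upwards [isOpen_Ioo.mem_nhds hx] with y hy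
      exact extendFrom_extends hc y hy)
  have hint := intervalIntegral.integrableOn_deriv_of_nonneg hext hd hpos
  refine ⟨hint.mono_set Ioo_subset_Ioc_self, ?_⟩
  rw [← integral_Ioc_eq_integral_Ioo, ← intervalIntegral.integral_of_le hab.le]
  exact intervalIntegral.integral_eq_sub_of_hasDerivAt_of_tendsto hab hderiv
    ((intervalIntegrable_iff_integrableOn_Ioc_of_le hab.le).2 hint) ha hb

theorem tendsto_sin_mul_div_sin_mul (a : ℝ) {b : ℝ} (hb : b ≠ 0) :
    Tendsto (fun x : ℝ => Real.sin (a * x) / Real.sin (b * x)) (𝓝[>] 0) (𝓝 (a / b)) := by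
  have h : ∀ c : ℝ, Tendsto (fun x : ℝ => c * Real.sinc (c * x)) (𝓝[>] 0) (𝓝 c) := by
    intro c
    have : Continuous fun x : ℝ => c * Real.sinc (c * x) := by
      have := Real.continuous_sinc
      fun_prop
    simpa using (this.tendsto 0).mono_left nhdsWithin_le_nhds
  have hs : ∀ c x : ℝ, x ≠ 0 → Real.sin (c * x) = c * Real.sinc (c * x) * x := by
    intro c x hx
    by_cases hc : c = 0
    · simp [hc]
    · rw [Real.sinc_of_ne_zero (mul_ne_zero hc hx)]
      field_simp
  refine ((h a).div (h b) hb).congr' ?_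
  filter_upwards [self_mem_nhdsWithin] with x hx
  have hx0 : x ≠ 0 := ne_of_gt hx
  rw [Pi.div_apply, hs a x hx0, hs b x hx0, mul_div_mul_right _ _ hx0]

/-! ### The parametrization and its curve -/

section Angles

variable {p φ : ℝ}

theorem lt_pi_div_two_of_mem (hp : 2 ≤ p) (hφ : φ ∈ Ioo 0 (Real.pi / p)) : φ < Real.pi / 2 :=
  hφ.2.trans_le (div_le_div_of_nonneg_left Real.pi_pos.le two_pos hp)

theorem mul_lt_pi_of_mem (hp : 2 ≤ p) (hφ : φ ∈ Ioo 0 (Real.pi / p)) : p * φ < Real.pi := by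
  have := (lt_div_iff₀ (by linarith)).1 hφ.2
  linarith

theorem sin_pos_of_mem (hp : 2 ≤ p) (hφ : φ ∈ Ioo 0 (Real.pi / p)) : 0 < Real.sin φ :=
  Real.sin_pos_of_pos_of_lt_pi hφ.1 (by linarith [lt_pi_div_two_of_mem hp hφ, Real.pi_pos])

theorem cos_pos_of_mem (hp : 2 ≤ p) (hφ : φ ∈ Ioo 0 (Real.pi / p)) : 0 < Real.cos φ :=
  Real.cos_pos_of_mem_Ioo ⟨by linarith [hφ.1, Real.pi_pos], lt_pi_div_two_of_mem hp hφ⟩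

theorem sin_mul_pos_of_mem (hp : 2 ≤ p) (hφ : φ ∈ Ioo 0 (Real.pi / p)) : 0 < Real.sin (p * φ) :=
  Real.sin_pos_of_pos_of_lt_pi (mul_pos (by linarith) hφ.1) (mul_lt_pi_of_mem hp hφ)

theorem sin_sub_one_mul_pos_of_mem (hp : 2 ≤ p) (hφ : φ ∈ Ioo 0 (Real.pi / p)) :
    0 < Real.sin ((p - 1) * φ) :=
  Real.sin_pos_of_pos_of_lt_pi (mul_pos (by linarith) hφ.1)
    (by linarith [mul_lt_pi_of_mem hp hφ, hφ.1])

end Angles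

/-- The negative of the logarithmic derivative of `fussCatalanParam p`. -/
noncomputable def fussCatalanLogDeriv (p φ : ℝ) : ℝ :=
  Real.cos φ / Real.sin φ + (p - 1) ^ 2 * (Real.cos ((p - 1) * φ) / Real.sin ((p - 1) * φ)) -
    p ^ 2 * (Real.cos (p * φ) / Real.sin (p * φ))

/-- The curve on which `z ^ p / (z - 1)` is real. -/
noncomputable def fussCatalanCurve (p φ : ℝ) : ℂ :=
  ((Real.sin (p * φ) / Real.sin ((p - 1) * φ) : ℝ) : ℂ) * Complex.exp (φ * Complex.I)

section Curve

variable {p φ : ℝ}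

/-- Over the common denominator of the three sines, the addition formulas turn the numerator into a
sum of two squares. -/
theorem fussCatalanLogDeriv_pos (hp : 2 ≤ p) (hφ : φ ∈ Ioo 0 (Real.pi / p)) :
    0 < fussCatalanLogDeriv p φ := by
  have hx := sin_pos_of_mem hp hφ
  have hy := sin_sub_one_mul_pos_of_mem hp hφ
  have hz := sin_mul_pos_of_mem hp hφ
  have hsz : Real.sin (p * φ) = Real.sin φ * Real.cos ((p - 1) * φ) +
      Real.cos φ * Real.sin ((p - 1) * φ) := by
    rw [← Real.sin_add]; congr 1; ring
  have hcz : Real.cos (p * φ) = Real.cos φ * Real.cos ((p - 1) * φ) -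
      Real.sin φ * Real.sin ((p - 1) * φ) := by
    rw [← Real.cos_add]; congr 1; ring
  have key : fussCatalanLogDeriv p φ =
      ((p * Real.sin φ * Real.sin ((p - 1) * φ)) ^ 2 +
        (Real.cos φ * Real.sin ((p - 1) * φ) - (p - 1) * Real.cos ((p - 1) * φ) * Real.sin φ) ^ 2) /
        (Real.sin φ * Real.sin ((p - 1) * φ) * Real.sin (p * φ)) := by
    unfold fussCatalanLogDeriv
    rw [eq_div_iff (by positivity)]
    field_simp
    rw [hsz, hcz]
    ring
  rw [key]
  have : 0 < p := by linarith
  positivity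

theorem fussCatalanParam_pos (hp : 2 ≤ p) (hφ : φ ∈ Ioo 0 (Real.pi / p)) :
    0 < fussCatalanParam p φ := by
  have hx := sin_pos_of_mem hp hφ
  have hy := sin_sub_one_mul_pos_of_mem hp hφ
  have hz := sin_mul_pos_of_mem hp hφ
  unfold fussCatalanParam
  positivity

theorem hasDerivAt_sin_mul (c φ : ℝ) :
    HasDerivAt (fun x => Real.sin (c * x)) (c * Real.cos (c * φ)) φ := by
  simpa [mul_comm] using ((hasDerivAt_id φ).const_mul c).sin

theorem hasDerivAt_fussCatalanParam (hp : 2 ≤ p) (hφ : φ ∈ Ioo 0 (Real.pi / p)) :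
    HasDerivAt (fussCatalanParam p) (-(fussCatalanParam p φ * fussCatalanLogDeriv p φ)) φ := by
  have hx := sin_pos_of_mem hp hφ
  have hy := sin_sub_one_mul_pos_of_mem hp hφ
  have hz := sin_mul_pos_of_mem hp hφ
  have h1 := (hasDerivAt_sin_mul p φ).rpow_const (p := p) (Or.inl hz.ne')
  have h2 := (hasDerivAt_sin_mul (p - 1) φ).rpow_const (p := p - 1) (Or.inl hy.ne')
  have hyp := Real.rpow_pos_of_pos hy (p - 1)
  have h3 : HasDerivAt (fun x => Real.sin x * Real.sin ((p - 1) * x) ^ (p - 1)) _ φ :=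
    (Real.hasDerivAt_sin φ).mul h2
  refine (h1.div h3 (by positivity)).congr_deriv ?_
  rw [Real.rpow_sub_one hz.ne' p, Real.rpow_sub_one hy.ne' (p - 1)]
  unfold fussCatalanParam fussCatalanLogDeriv
  have hzp := Real.rpow_pos_of_pos hz p
  generalize Real.sin ((p - 1) * φ) ^ (p - 1) = Y at *
  generalize Real.sin (p * φ) ^ p = Z at *
  generalize Real.sin ((p - 1) * φ) = y at *
  generalize Real.cos ((p - 1) * φ) = cy at *
  field_simp
  ring

theorem strictAntiOn_fussCatalanParam (hp : 2 ≤ p) :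
    StrictAntiOn (fussCatalanParam p) (Ioo 0 (Real.pi / p)) := by
  refine strictAntiOn_of_deriv_neg (convex_Ioo _ _)
    (fun φ hφ => (hasDerivAt_fussCatalanParam hp hφ).continuousAt.continuousWithinAt) ?_
  intro φ hφ
  rw [interior_Ioo] at hφ
  rw [(hasDerivAt_fussCatalanParam hp hφ).deriv, neg_lt_zero]
  exact mul_pos (fussCatalanParam_pos hp hφ) (fussCatalanLogDeriv_pos hp hφ)

/-- The law of sines in the triangle with vertices `0`, `1`, `B`, whose angles are `φ`, `π - pφ` and
`(p - 1)φ`. -/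
theorem fussCatalanCurve_sub_one (hp : 2 ≤ p) (hφ : φ ∈ Ioo 0 (Real.pi / p)) :
    fussCatalanCurve p φ - 1 = ((Real.sin φ / Real.sin ((p - 1) * φ) : ℝ) : ℂ) *
      Complex.exp (((p * φ : ℝ) : ℂ) * Complex.I) := by
  have hy := (sin_sub_one_mul_pos_of_mem hp hφ).ne'
  have hsz : Real.sin ((p - 1) * φ) = Real.sin (p * φ) * Real.cos φ -
      Real.cos (p * φ) * Real.sin φ := by
    rw [← Real.sin_sub]; congr 1; ring
  unfold fussCatalanCurve
  apply Complex.ext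
  · rw [Complex.sub_re, Complex.re_ofReal_mul, Complex.re_ofReal_mul, Complex.exp_ofReal_mul_I_re,
      Complex.exp_ofReal_mul_I_re, Complex.one_re, div_mul_eq_mul_div, div_mul_eq_mul_div,
      div_sub_one hy]
    congr 1
    rw [hsz]; ring
  · rw [Complex.sub_im, Complex.im_ofReal_mul, Complex.im_ofReal_mul, Complex.exp_ofReal_mul_I_im,
      Complex.exp_ofReal_mul_I_im, Complex.one_im]
    ring

theorem fussCatalanCurve_cpow (hp : 2 ≤ p) (hφ : φ ∈ Ioo 0 (Real.pi / p)) (a : ℝ) :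
    fussCatalanCurve p φ ^ (a : ℂ) =
      (((Real.sin (p * φ) / Real.sin ((p - 1) * φ)) ^ a : ℝ) : ℂ) *
        Complex.exp (((a * φ : ℝ) : ℂ) * Complex.I) := by
  have hR : 0 < Real.sin (p * φ) / Real.sin ((p - 1) * φ) :=
    div_pos (sin_mul_pos_of_mem hp hφ) (sin_sub_one_mul_pos_of_mem hp hφ)
  have hlog : Complex.log (Complex.exp (φ * Complex.I)) = φ * Complex.I :=
    Complex.log_exp (by simpa using by linarith [hφ.1, Real.pi_pos])
      (by simpa using by linarith [lt_pi_div_two_of_mem hp hφ, Real.pi_pos])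
  unfold fussCatalanCurve
  rw [Complex.cpow_def_of_ne_zero (mul_ne_zero (by exact_mod_cast hR.ne') (Complex.exp_ne_zero _)),
    Complex.log_ofReal_mul hR (Complex.exp_ne_zero _), hlog, Real.rpow_def_of_pos hR,
    Complex.ofReal_exp, ← Complex.exp_add]
  congr 1
  push_cast
  ring

theorem fussCatalanCurve_cpow_self (hp : 2 ≤ p) (hφ : φ ∈ Ioo 0 (Real.pi / p)) :
    fussCatalanCurve p φ ^ (p : ℂ) = fussCatalanParam p φ * (fussCatalanCurve p φ - 1) := by
  have hx := sin_pos_of_mem hp hφ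
  have hy := sin_sub_one_mul_pos_of_mem hp hφ
  have hz := sin_mul_pos_of_mem hp hφ
  rw [fussCatalanCurve_sub_one hp hφ, fussCatalanCurve_cpow hp hφ, ← mul_assoc,
    ← Complex.ofReal_mul]
  congr 2
  unfold fussCatalanParam
  rw [Real.div_rpow hz.le hy.le, Real.rpow_sub_one hy.ne']
  have := Real.rpow_pos_of_pos hy p
  generalize Real.sin ((p - 1) * φ) = y at *
  field_simp

theorem fussCatalanCurve_im (p φ : ℝ) : (fussCatalanCurve p φ).im =
    Real.sin (p * φ) / Real.sin ((p - 1) * φ) * Real.sin φ := by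
  rw [fussCatalanCurve, Complex.im_ofReal_mul, Complex.exp_ofReal_mul_I_im]

theorem fussCatalanCurve_re (p φ : ℝ) : (fussCatalanCurve p φ).re =
    Real.sin (p * φ) / Real.sin ((p - 1) * φ) * Real.cos φ := by
  rw [fussCatalanCurve, Complex.re_ofReal_mul, Complex.exp_ofReal_mul_I_re]

theorem fussCatalanCurve_mem (hp : 2 ≤ p) (hφ : φ ∈ Ioo 0 (Real.pi / p)) :
    fussCatalanCurve p φ ∈ upperHalfDisc := by
  have hx := sin_pos_of_mem hp hφ
  have hc := cos_pos_of_mem hp hφ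
  have hy := sin_sub_one_mul_pos_of_mem hp hφ
  have hz := sin_mul_pos_of_mem hp hφ
  refine ⟨?_, ?_⟩
  · rw [mem_ofPred_eq, fussCatalanCurve_im]
    positivity
  -- In polar coordinates the disc is `R < 4 cos φ`. Since `sin ((p - 2)φ) ≥ 0`, in fact `R ≤ 2 cos
  -- φ`.
  · have hR : Real.sin (p * φ) / Real.sin ((p - 1) * φ) < 4 * Real.cos φ := by
      rw [div_lt_iff₀ hy]
      have hsz : Real.sin (p * φ) = Real.sin φ * Real.cos ((p - 1) * φ) +
          Real.cos φ * Real.sin ((p - 1) * φ) := by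
        rw [← Real.sin_add]; congr 1; ring
      have hsub : 0 ≤ Real.sin ((p - 1) * φ) * Real.cos φ - Real.cos ((p - 1) * φ) * Real.sin φ := by
        rw [← Real.sin_sub]
        refine Real.sin_nonneg_of_nonneg_of_le_pi ?_ ?_
        · nlinarith [hφ.1]
        · linarith [mul_lt_pi_of_mem hp hφ, hφ.1]
      have := mul_pos hc hy
      linarith
    rw [Metric.mem_ball, Complex.dist_eq, ← sq_lt_sq₀ (norm_nonneg _) two_pos.le,
      ← Complex.normSq_eq_norm_sq, Complex.normSq_apply]
    simp only [Complex.sub_re, Complex.sub_im, Complex.re_ofNat, Complex.im_ofNat,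
      fussCatalanCurve_re, fussCatalanCurve_im]
    have hR0 := div_pos hz hy
    generalize Real.sin (p * φ) / Real.sin ((p - 1) * φ) = R at hR hR0
    have := Real.sin_sq_add_cos_sq φ
    have h2 : (R * Real.cos φ - 2) * (R * Real.cos φ - 2) +
        (R * Real.sin φ - 0) * (R * Real.sin φ - 0) =
        R ^ 2 * (Real.sin φ ^ 2 + Real.cos φ ^ 2) - 4 * R * Real.cos φ + 4 := by ring
    rw [h2, this]
    nlinarith

theorem differentiableAt_fussCatalanCurve (hp : 2 ≤ p) (hφ : φ ∈ Ioo 0 (Real.pi / p)) :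
    DifferentiableAt ℝ (fussCatalanCurve p) φ := by
  have hy := (sin_sub_one_mul_pos_of_mem hp hφ).ne'
  have h1 : DifferentiableAt ℝ (fun φ => Real.sin (p * φ) / Real.sin ((p - 1) * φ)) φ :=
    ((hasDerivAt_sin_mul p φ).div (hasDerivAt_sin_mul (p - 1) φ) hy).differentiableAt
  have h2 : DifferentiableAt ℝ (fun φ : ℝ => Complex.exp (φ * Complex.I)) φ := by
    have : HasDerivAt (fun z : ℂ => Complex.exp (z * Complex.I)) _ (φ : ℂ) :=
      ((hasDerivAt_id (φ : ℂ)).mul_const Complex.I).cexp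
    exact this.comp_ofReal.differentiableAt
  exact (h1.hasDerivAt.ofReal_comp.differentiableAt).mul h2

/-- Differentiate `B ^ p = ρ (B - 1)` on both sides; an explicit formula for `B'` is never needed.
-/
theorem deriv_fussCatalanCurve_mul (hp : 2 ≤ p) (hφ : φ ∈ Ioo 0 (Real.pi / p)) :
    (1 / (fussCatalanCurve p φ - 1) - p / fussCatalanCurve p φ) * deriv (fussCatalanCurve p) φ =
      fussCatalanLogDeriv p φ := by
  have hmem := fussCatalanCurve_mem hp hφ
  have hw := ne_one_of_mem_upperHalfDisc hmem
  have hre := re_pos_of_mem_ball_two hmem.2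
  have hB : fussCatalanCurve p φ ≠ 0 := by
    intro h
    rw [h] at hre
    simp at hre
  have hρ : (fussCatalanParam p φ : ℂ) ≠ 0 := by exact_mod_cast (fussCatalanParam_pos hp hφ).ne'
  have hC := (differentiableAt_fussCatalanCurve hp hφ).hasDerivAt
  have h1 := (hasDerivAt_cpow_ofReal hre p).comp φ hC
  have h2 := (hasDerivAt_fussCatalanParam hp hφ).ofReal_comp.mul (hC.sub_const 1)
  have heq : (fun φ => fussCatalanCurve p φ ^ (p : ℂ)) =ᶠ[𝓝 φ]
      fun φ => (fussCatalanParam p φ : ℂ) * (fussCatalanCurve p φ - 1) := by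
    filter_upwards [isOpen_Ioo.mem_nhds hφ] with ψ hψ using fussCatalanCurve_cpow_self hp hψ
  have h3 := (h2.congr_of_eventuallyEq heq).unique h1
  have hpow : fussCatalanCurve p φ ^ (p : ℂ) =
      fussCatalanCurve p φ ^ ((p - 1 : ℝ) : ℂ) * fussCatalanCurve p φ := by
    have : (p : ℂ) = ((p - 1 : ℝ) : ℂ) + 1 := by push_cast; ring
    conv_lhs => rw [this, Complex.cpow_add _ _ hB, Complex.cpow_one]
  rw [fussCatalanCurve_cpow_self hp hφ, ← div_eq_iff hB] at hpow
  rw [← hpow] at h3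
  push_cast at h3
  generalize deriv (fussCatalanCurve p) φ = D at *
  generalize fussCatalanCurve p φ = B at *
  field_simp at h3 ⊢
  linear_combination h3

/-- On the curve the quotient is `ρ ^ k * B ^ r` with `ρ` real. -/
theorem im_fussCatalanCurve_cpow_div (hp : 2 ≤ p) (hφ : φ ∈ Ioo 0 (Real.pi / p)) (r : ℝ) (k : ℕ) :
    (fussCatalanCurve p φ ^ ((p * k + r : ℝ) : ℂ) / (fussCatalanCurve p φ - 1) ^ k).im =
      fussCatalanParam p φ ^ k *
        ((Real.sin (p * φ) / Real.sin ((p - 1) * φ)) ^ r * Real.sin (r * φ)) := by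
  have hmem := fussCatalanCurve_mem hp hφ
  have hw := ne_one_of_mem_upperHalfDisc hmem
  have hB : fussCatalanCurve p φ ≠ 0 := by
    intro h
    have hre := re_pos_of_mem_ball_two hmem.2
    rw [h] at hre
    simp at hre
  have h1 : ((p * k + r : ℝ) : ℂ) = (p : ℂ) * (k : ℂ) + (r : ℂ) := by push_cast; rfl
  rw [h1, Complex.cpow_add _ _ hB, Complex.cpow_mul_nat, fussCatalanCurve_cpow_self hp hφ, mul_pow,
    mul_assoc, mul_div_assoc, mul_div_cancel_left₀ _ (pow_ne_zero _ hw), ← Complex.ofReal_pow,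
    Complex.im_ofReal_mul, fussCatalanCurve_cpow hp hφ, Complex.im_ofReal_mul,
    Complex.exp_ofReal_mul_I_im]

theorem tendsto_fussCatalanCurve_zero (hp : 2 ≤ p) :
    Tendsto (fussCatalanCurve p) (𝓝[>] 0) (𝓝[upperHalfDisc] ((p / (p - 1) : ℝ) : ℂ)) := by
  refine tendsto_nhdsWithin_iff.2 ⟨?_, ?_⟩
  · have h1 := (Complex.continuous_ofReal.tendsto _).comp
      (tendsto_sin_mul_div_sin_mul p (by linarith : p - 1 ≠ 0))
    have h2 : Tendsto (fun φ : ℝ => Complex.exp (φ * Complex.I)) (𝓝[>] 0) (𝓝 1) := by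
      have : Continuous fun φ : ℝ => Complex.exp (φ * Complex.I) := by fun_prop
      simpa using (this.tendsto 0).mono_left nhdsWithin_le_nhds
    have h3 := h1.mul h2
    rw [mul_one] at h3
    exact h3
  · filter_upwards [Ioo_mem_nhdsGT (div_pos Real.pi_pos (by linarith : 0 < p))] with φ hφ
    exact fussCatalanCurve_mem hp hφ

theorem sin_sub_one_mul_pi_div_pos (hp : 2 ≤ p) : 0 < Real.sin ((p - 1) * (Real.pi / p)) := by
  have hp0 : 0 < p := by linarith
  refine Real.sin_pos_of_pos_of_lt_pi (mul_pos (by linarith) (div_pos Real.pi_pos hp0)) ?_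
  rw [mul_div_assoc', div_lt_iff₀ hp0]
  nlinarith [Real.pi_pos]

theorem tendsto_fussCatalanCurve_pi_div (hp : 2 ≤ p) :
    Tendsto (fussCatalanCurve p) (𝓝[<] (Real.pi / p)) (𝓝[upperHalfDisc] 0) := by
  have hp0 : 0 < p := by linarith
  refine tendsto_nhdsWithin_iff.2 ⟨?_, ?_⟩
  · have hy := (sin_sub_one_mul_pi_div_pos hp).ne'
    have h1 : ContinuousAt (fun φ => Real.sin (p * φ) / Real.sin ((p - 1) * φ)) (Real.pi / p) :=
      ((hasDerivAt_sin_mul p _).div (hasDerivAt_sin_mul (p - 1) _) hy).continuousAt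
    have h2 : ContinuousAt (fussCatalanCurve p) (Real.pi / p) :=
      (Complex.continuous_ofReal.continuousAt.comp h1).mul (by fun_prop)
    have h3 : fussCatalanCurve p (Real.pi / p) = 0 := by
      rw [fussCatalanCurve, mul_div_cancel₀ _ hp0.ne']
      simp
    have := h2.tendsto
    rw [h3] at this
    exact this.mono_left nhdsWithin_le_nhds
  · filter_upwards [Ioo_mem_nhdsLT (div_pos Real.pi_pos hp0)] with φ hφ
    exact fussCatalanCurve_mem hp hφ

theorem tendsto_fussCatalanParam_pi_div (hp : 2 ≤ p) :
    Tendsto (fussCatalanParam p) (𝓝[<] (Real.pi / p)) (𝓝 0) := by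
  have hp0 : 0 < p := by linarith
  have hπ := div_pos Real.pi_pos hp0
  have hy := sin_sub_one_mul_pi_div_pos hp
  have hx : 0 < Real.sin (Real.pi / p) := Real.sin_pos_of_pos_of_lt_pi hπ
    (div_lt_self Real.pi_pos (by linarith))
  have hc : ContinuousAt (fussCatalanParam p) (Real.pi / p) := by
    refine ContinuousAt.div ?_ (Real.continuous_sin.continuousAt.mul ?_) ?_
    · exact ContinuousAt.rpow_const (by fun_prop) (Or.inr hp0.le)
    · exact ContinuousAt.rpow_const (by fun_prop) (Or.inl hy.ne')
    · exact (mul_pos hx (Real.rpow_pos_of_pos hy _)).ne'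
  have h0 : fussCatalanParam p (Real.pi / p) = 0 := by
    rw [fussCatalanParam, mul_div_cancel₀ _ hp0.ne', Real.sin_pi, Real.zero_rpow hp0.ne', zero_div]
  have := hc.tendsto
  rw [h0] at this
  exact this.mono_left nhdsWithin_le_nhds

theorem exists_fussCatalanParam_le (hp : 2 ≤ p) :
    ∃ C : ℝ, 0 < C ∧ ∀ φ ∈ Ioo 0 (Real.pi / p), fussCatalanParam p φ ≤ C := by
  have hp0 : 0 < p := by linarith
  have hπ := div_pos Real.pi_pos hp0
  have h1 := (tendsto_sin_mul_div_sin_mul p (by linarith : p - 1 ≠ 0)).rpow_const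
    (p := p) (Or.inr hp0.le)
  have h2 := tendsto_sin_mul_div_sin_mul 1 (by linarith : p - 1 ≠ 0)
  have h3 := h1.div h2 (by
    have : 0 < p - 1 := by linarith
    positivity)
  have hmem := Ioo_mem_nhdsGT hπ
  -- The bound is the limit at `0`, equal to `p ^ p / (p - 1) ^ (p - 1)`; it dominates because `ρ`
  -- decreases.
  have h4 : Tendsto (fussCatalanParam p) (𝓝[>] 0) (𝓝 ((p / (p - 1)) ^ p / (1 / (p - 1)))) := by
    refine h3.congr' ?_
    filter_upwards [hmem] with φ hφ
    have hx := sin_pos_of_mem hp hφ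
    have hy := sin_sub_one_mul_pos_of_mem hp hφ
    have hz := sin_mul_pos_of_mem hp hφ
    rw [Pi.div_apply, one_mul, Real.div_rpow hz.le hy.le, fussCatalanParam,
      Real.rpow_sub_one hy.ne']
    have := Real.rpow_pos_of_pos hy p
    field_simp
  have hL : 0 < (p / (p - 1)) ^ p / (1 / (p - 1)) := by
    have : 0 < p - 1 := by linarith
    positivity
  refine ⟨_, hL, fun φ hφ => ge_of_tendsto h4 ?_⟩
  filter_upwards [Ioo_mem_nhdsGT hφ.1] with ψ hψ
  exact (strictAntiOn_fussCatalanParam hp ⟨hψ.1, hψ.2.trans hφ.2⟩ hφ hψ.2).le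

/-- The integrand is the derivative of `Im (H (B(φ)))`, with `H` the primitive above. The condition
`r ≤ p` keeps `sin (rφ)`, hence the integrand, nonnegative. -/
theorem integral_fussCatalanParam_pow (hp : 2 ≤ p) {r : ℝ} (hr : 0 < r) (hrp : r ≤ p) (k : ℕ) :
    IntegrableOn (fun φ => fussCatalanLogDeriv p φ * (fussCatalanParam p φ ^ k *
        ((Real.sin (p * φ) / Real.sin ((p - 1) * φ)) ^ r * Real.sin (r * φ))))
        (Ioo 0 (Real.pi / p)) ∧
      ∫ φ in Ioo 0 (Real.pi / p), fussCatalanLogDeriv p φ * (fussCatalanParam p φ ^ k *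
        ((Real.sin (p * φ) / Real.sin ((p - 1) * φ)) ^ r * Real.sin (r * φ))) =
        Real.pi * fussCatalanNumber p r k := by
  obtain ⟨H, hH, hHx, hH0⟩ := exists_primitive_fussCatalan (by linarith : 1 ≤ p) hr k
  have hp1 : 0 < p - 1 := by linarith
  have h0 := (hHx (p / (p - 1)) (by rw [lt_div_iff₀ hp1]; linarith)
    (by rw [div_lt_iff₀ hp1]; linarith)).comp (tendsto_fussCatalanCurve_zero hp)
  have h1 := hH0.comp (tendsto_fussCatalanCurve_pi_div hp)
  have := integral_Ioo_of_hasDerivAt_of_nonneg (f := fun φ => (H (fussCatalanCurve p φ)).im)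
    (f' := fun φ => fussCatalanLogDeriv p φ * (fussCatalanParam p φ ^ k *
        ((Real.sin (p * φ) / Real.sin ((p - 1) * φ)) ^ r * Real.sin (r * φ))))
    (div_pos Real.pi_pos (by linarith : 0 < p)) ?_ ?_ h0 h1
  · rwa [sub_zero] at this
  · intro φ hφ
    have hd := (hH _ (fussCatalanCurve_mem hp hφ)).comp φ
      (differentiableAt_fussCatalanCurve hp hφ).hasDerivAt
    have hd2 := Complex.imCLM.hasFDerivAt.comp_hasDerivAt φ hd
    rw [mul_assoc, deriv_fussCatalanCurve_mul hp hφ, mul_comm, Complex.imCLM_apply,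
      Complex.im_ofReal_mul, im_fussCatalanCurve_cpow_div hp hφ] at hd2
    exact hd2
  · intro φ hφ
    have := fussCatalanLogDeriv_pos hp hφ
    have := fussCatalanParam_pos hp hφ
    have hy := sin_sub_one_mul_pos_of_mem hp hφ
    have hz := sin_mul_pos_of_mem hp hφ
    have : 0 ≤ Real.sin (r * φ) := Real.sin_nonneg_of_nonneg_of_le_pi (mul_pos hr hφ.1).le
      ((mul_le_mul_of_nonneg_right hrp hφ.1.le).trans (mul_lt_pi_of_mem hp hφ).le)
    positivity

end Curve

/-! ### The density and its monotonicity -/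

/-- The density of the Fuss-Catalan distribution with parameters `2r, r` in the coordinate `φ`. -/
noncomputable def fussCatalanAngularDensity (r φ : ℝ) : ℝ :=
  Real.sin ((2 * r - 1) * φ) ^ (r - 1) * Real.sin φ * Real.sin (r * φ) /
    (Real.pi * Real.sin (2 * r * φ) ^ r)

/-- The density of the Fuss-Catalan distribution with parameters `2r, r`. -/
noncomputable def fussCatalanDensity (r : ℝ) : ℝ → ℝ :=
  (fussCatalanParam (2 * r) '' Ioo 0 (Real.pi / (2 * r))).indicator fun x =>
    fussCatalanAngularDensity r
      (Function.invFunOn (fussCatalanParam (2 * r)) (Ioo 0 (Real.pi / (2 * r))) x)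

section Density

variable {r : ℝ}

/-- The numerator of the derivative is `p sin φ - cos ((p - 1)φ) sin (pφ)`, which vanishes at `0`
and has derivative `(2p - 1) sin ((p - 1)φ) sin (pφ) ≥ 0`. -/
theorem sin_sub_one_mul_div_sin_mul_monotoneOn {p : ℝ} (hp : 2 ≤ p) :
    MonotoneOn (fun φ => Real.sin ((p - 1) * φ) / Real.sin (p * φ)) (Ioo 0 (Real.pi / p)) := by
  have hnum : ∀ φ ∈ Ioo 0 (Real.pi / p),
      0 ≤ p * Real.sin φ - Real.cos ((p - 1) * φ) * Real.sin (p * φ) := by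
    have hder : ∀ φ : ℝ, HasDerivAt
        (fun φ => p * Real.sin φ - Real.cos ((p - 1) * φ) * Real.sin (p * φ))
        ((2 * p - 1) * (Real.sin ((p - 1) * φ) * Real.sin (p * φ))) φ := by
      intro φ
      have h1 : HasDerivAt (fun φ => Real.cos ((p - 1) * φ))
          (-Real.sin ((p - 1) * φ) * (p - 1)) φ := by
        simpa using ((hasDerivAt_id φ).const_mul (p - 1)).cos
      have hc : Real.cos φ = Real.cos (p * φ) * Real.cos ((p - 1) * φ) +
          Real.sin (p * φ) * Real.sin ((p - 1) * φ) := by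
        rw [← Real.cos_sub]; congr 1; ring
      refine (((Real.hasDerivAt_sin φ).const_mul p).sub
        (h1.mul (hasDerivAt_sin_mul p φ))).congr_deriv ?_
      rw [hc]; ring
    have hmono : MonotoneOn (fun φ => p * Real.sin φ - Real.cos ((p - 1) * φ) * Real.sin (p * φ))
        (Ico 0 (Real.pi / p)) := by
      refine monotoneOn_of_deriv_nonneg (convex_Ico _ _)
        (fun φ _ => (hder φ).continuousAt.continuousWithinAt)
        (fun φ _ => (hder φ).differentiableAt.differentiableWithinAt) fun φ hφ => ?_
      rw [interior_Ico] at hφ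
      rw [(hder φ).deriv]
      exact mul_nonneg (by linarith) (mul_pos (sin_sub_one_mul_pos_of_mem hp hφ)
        (sin_mul_pos_of_mem hp hφ)).le
    intro φ hφ
    simpa using hmono ⟨le_rfl, hφ.1.trans hφ.2⟩ ⟨hφ.1.le, hφ.2⟩ hφ.1.le
  have hder : ∀ φ ∈ Ioo 0 (Real.pi / p),
      HasDerivAt (fun φ => Real.sin ((p - 1) * φ) / Real.sin (p * φ)) _ φ := fun φ hφ =>
    (hasDerivAt_sin_mul (p - 1) φ).div (hasDerivAt_sin_mul p φ) (sin_mul_pos_of_mem hp hφ).ne'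
  refine monotoneOn_of_deriv_nonneg (convex_Ioo _ _)
    (fun φ hφ => (hder φ hφ).continuousAt.continuousWithinAt)
    (fun φ hφ => (hder φ (interior_subset hφ)).differentiableAt.differentiableWithinAt)
    fun φ hφ => ?_
  rw [interior_Ioo] at hφ
  rw [(hder φ hφ).deriv]
  refine div_nonneg ?_ (sq_nonneg _)
  have hs : Real.sin φ = Real.sin (p * φ) * Real.cos ((p - 1) * φ) -
      Real.cos (p * φ) * Real.sin ((p - 1) * φ) := by
    rw [← Real.sin_sub]; congr 1; ring
  have := hnum φ hφ
  rw [hs] at this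
  linarith

theorem mul_mem_of_mem (hr : 1 ≤ r) {φ : ℝ} (hφ : φ ∈ Ioo 0 (Real.pi / (2 * r))) :
    r * φ ∈ Ioo 0 (Real.pi / 2) := by
  have := (lt_div_iff₀ (by linarith)).1 hφ.2
  exact ⟨mul_pos (by linarith) hφ.1, by linarith⟩

/-- The choice `p = 2r` enters through `sin (2rφ) = 2 sin (rφ) cos (rφ)`; the resulting factors are
each nondecreasing in `φ`. -/
theorem fussCatalanAngularDensity_eq (hr : 1 ≤ r) {φ : ℝ}
    (hφ : φ ∈ Ioo 0 (Real.pi / (2 * r))) :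
    fussCatalanAngularDensity r φ =
      (Real.sin ((2 * r - 1) * φ) / Real.sin (2 * r * φ)) ^ (r - 1) *
        (Real.sin φ / Real.cos (r * φ)) / (2 * Real.pi) := by
  have hp : 2 ≤ 2 * r := by linarith
  have hy := sin_sub_one_mul_pos_of_mem hp hφ
  have hz := sin_mul_pos_of_mem hp hφ
  have hm := mul_mem_of_mem hr hφ
  have hc := Real.cos_pos_of_mem_Ioo ⟨by linarith [hm.1, Real.pi_pos], hm.2⟩
  have hs := Real.sin_pos_of_pos_of_lt_pi hm.1 (by linarith [hm.2, Real.pi_pos])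
  have h2 : Real.sin (2 * r * φ) = 2 * Real.sin (r * φ) * Real.cos (r * φ) := by
    rw [mul_assoc 2 r φ, Real.sin_two_mul]
  have hpow : Real.sin (2 * r * φ) ^ r = Real.sin (2 * r * φ) ^ (r - 1) *
      (2 * Real.sin (r * φ) * Real.cos (r * φ)) := by
    rw [← h2, Real.rpow_sub_one hz.ne', div_mul_cancel₀ _ hz.ne']
  have hzp := Real.rpow_pos_of_pos hz (r - 1)
  unfold fussCatalanAngularDensity
  rw [hpow, Real.div_rpow hy.le hz.le]
  generalize Real.sin ((2 * r - 1) * φ) ^ (r - 1) = Y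
  generalize Real.sin (2 * r * φ) ^ (r - 1) = Z at *
  field_simp

theorem fussCatalanAngularDensity_monotoneOn (hr : 1 ≤ r) :
    MonotoneOn (fussCatalanAngularDensity r) (Ioo 0 (Real.pi / (2 * r))) := by
  have hp : 2 ≤ 2 * r := by linarith
  intro φ hφ ψ hψ h
  rw [fussCatalanAngularDensity_eq hr hφ, fussCatalanAngularDensity_eq hr hψ]
  have hm := mul_mem_of_mem hr hφ
  have hm' := mul_mem_of_mem hr hψ
  have hc' := Real.cos_pos_of_mem_Ioo ⟨by linarith [hm'.1, Real.pi_pos], hm'.2⟩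
  have hcos : Real.cos (r * ψ) ≤ Real.cos (r * φ) :=
    Real.cos_le_cos_of_nonneg_of_le_pi hm.1.le (by linarith [hm'.2, Real.pi_pos])
      (mul_le_mul_of_nonneg_left h (by linarith))
  have hsin : Real.sin φ ≤ Real.sin ψ :=
    Real.sin_le_sin_of_le_of_le_pi_div_two (by linarith [hφ.1, Real.pi_pos])
      (lt_pi_div_two_of_mem hp hψ).le h
  have h1 := sin_sub_one_mul_div_sin_mul_monotoneOn hp hφ hψ h
  have h0 := div_pos (sin_sub_one_mul_pos_of_mem hp hφ) (sin_mul_pos_of_mem hp hφ)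
  have h0' := div_pos (sin_sub_one_mul_pos_of_mem hp hψ) (sin_mul_pos_of_mem hp hψ)
  refine div_le_div_of_nonneg_right (mul_le_mul (Real.rpow_le_rpow h0.le h1 (by linarith))
    (div_le_div₀ (sin_pos_of_mem hp hψ).le hsin hc' hcos)
    (div_pos (sin_pos_of_mem hp hφ) (hc'.trans_le hcos)).le
    (Real.rpow_nonneg h0'.le _)) (by positivity)

theorem fussCatalanAngularDensity_nonneg (hr : 1 ≤ r) {φ : ℝ}
    (hφ : φ ∈ Ioo 0 (Real.pi / (2 * r))) : 0 ≤ fussCatalanAngularDensity r φ := by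
  have hp : 2 ≤ 2 * r := by linarith
  have hm := mul_mem_of_mem hr hφ
  have hx := sin_pos_of_mem hp hφ
  have hy := sin_sub_one_mul_pos_of_mem hp hφ
  have hz := sin_mul_pos_of_mem hp hφ
  have hs := Real.sin_pos_of_pos_of_lt_pi hm.1 (by linarith [hm.2, Real.pi_pos])
  unfold fussCatalanAngularDensity
  positivity

theorem fussCatalanParam_mul_angularDensity (hr : 1 ≤ r) {φ : ℝ}
    (hφ : φ ∈ Ioo 0 (Real.pi / (2 * r))) :
    fussCatalanParam (2 * r) φ * fussCatalanAngularDensity r φ =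
      (Real.sin (2 * r * φ) / Real.sin ((2 * r - 1) * φ)) ^ r * Real.sin (r * φ) / Real.pi := by
  have hp : 2 ≤ 2 * r := by linarith
  have hx := sin_pos_of_mem hp hφ
  have hy := sin_sub_one_mul_pos_of_mem hp hφ
  have hz := sin_mul_pos_of_mem hp hφ
  have hzp := Real.rpow_pos_of_pos hz r
  have hyp := Real.rpow_pos_of_pos hy r
  have hyp' := Real.rpow_pos_of_pos hy (r - 1)
  unfold fussCatalanAngularDensity fussCatalanParam
  have h1 : Real.sin (2 * r * φ) ^ (2 * r) = Real.sin (2 * r * φ) ^ r * Real.sin (2 * r * φ) ^ r := by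
    rw [← Real.rpow_add hz, two_mul r]
  have h2 : Real.sin ((2 * r - 1) * φ) ^ (2 * r - 1) =
      Real.sin ((2 * r - 1) * φ) ^ (r - 1) * Real.sin ((2 * r - 1) * φ) ^ r := by
    rw [← Real.rpow_add hy]; congr 1; ring
  rw [Real.div_rpow hz.le hy.le, h1, h2]
  generalize Real.sin ((2 * r - 1) * φ) ^ (r - 1) = Y at *
  generalize Real.sin ((2 * r - 1) * φ) ^ r = Y' at *
  generalize Real.sin (2 * r * φ) ^ r = Z at *
  field_simp

theorem fussCatalanDensity_param (hr : 1 ≤ r) {φ : ℝ} (hφ : φ ∈ Ioo 0 (Real.pi / (2 * r))) :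
    fussCatalanDensity r (fussCatalanParam (2 * r) φ) = fussCatalanAngularDensity r φ := by
  rw [fussCatalanDensity, indicator_of_mem (mem_image_of_mem _ hφ)]
  rw [(strictAntiOn_fussCatalanParam (by linarith : 2 ≤ 2 * r)).injOn.leftInvOn_invFunOn hφ]

theorem fussCatalanDensity_of_notMem {x : ℝ}
    (hx : x ∉ fussCatalanParam (2 * r) '' Ioo 0 (Real.pi / (2 * r))) :
    fussCatalanDensity r x = 0 :=
  indicator_of_notMem hx _

theorem fussCatalanDensity_nonneg (hr : 1 ≤ r) (x : ℝ) : 0 ≤ fussCatalanDensity r x := by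
  by_cases hx : x ∈ fussCatalanParam (2 * r) '' Ioo 0 (Real.pi / (2 * r))
  · obtain ⟨φ, hφ, rfl⟩ := hx
    rw [fussCatalanDensity_param hr hφ]
    exact fussCatalanAngularDensity_nonneg hr hφ
  · rw [fussCatalanDensity_of_notMem hx]

theorem fussCatalanDensity_of_nonpos (hr : 1 ≤ r) {x : ℝ} (hx : x ≤ 0) :
    fussCatalanDensity r x = 0 := by
  refine fussCatalanDensity_of_notMem ?_
  rintro ⟨φ, hφ, rfl⟩
  exact hx.not_gt (fussCatalanParam_pos (by linarith) hφ)

theorem ordConnected_image_fussCatalanParam {p : ℝ} (hp : 2 ≤ p) :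
    OrdConnected (fussCatalanParam p '' Ioo 0 (Real.pi / p)) :=
  (isPreconnected_Ioo.image _ fun _ hφ =>
    (hasDerivAt_fussCatalanParam hp hφ).continuousAt.continuousWithinAt).ordConnected

/-- The image is an interval reaching down to `0`, since `ρ` tends to `0` at `π / p`. Hence the
density has no gap before its support. -/
theorem mem_image_fussCatalanParam_of_le {p : ℝ} (hp : 2 ≤ p) {x y : ℝ} (hx : 0 < x) (hxy : x ≤ y)
    (hy : y ∈ fussCatalanParam p '' Ioo 0 (Real.pi / p)) :
    x ∈ fussCatalanParam p '' Ioo 0 (Real.pi / p) := by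
  have h1 := (tendsto_fussCatalanParam_pi_div hp).eventually (gt_mem_nhds hx)
  have h2 := Ioo_mem_nhdsLT (div_pos Real.pi_pos (by linarith : 0 < p))
  obtain ⟨φ, hφ, hφI⟩ := (h1.and h2).exists
  exact (ordConnected_image_fussCatalanParam hp).out (mem_image_of_mem _ hφI) hy ⟨hφ.le, hxy⟩

theorem fussCatalanDensity_antitoneOn (hr : 1 ≤ r) : AntitoneOn (fussCatalanDensity r) (Ioi 0) := by
  intro x hx y _ hxy
  have hp : 2 ≤ 2 * r := by linarith
  by_cases hy : y ∈ fussCatalanParam (2 * r) '' Ioo 0 (Real.pi / (2 * r))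
  · obtain ⟨φ, hφ, rfl⟩ := mem_image_fussCatalanParam_of_le hp hx hxy hy
    obtain ⟨ψ, hψ, rfl⟩ := hy
    rw [fussCatalanDensity_param hr hφ, fussCatalanDensity_param hr hψ]
    exact fussCatalanAngularDensity_monotoneOn hr hψ hφ
      (((strictAntiOn_fussCatalanParam hp).le_iff_ge hφ hψ).1 hxy)
  · rw [fussCatalanDensity_of_notMem hy]
    exact fussCatalanDensity_nonneg hr x

theorem measurable_fussCatalanDensity (hr : 1 ≤ r) : Measurable (fussCatalanDensity r) := by
  refine measurable_of_Ici fun c => ?_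
  rcases le_or_gt c 0 with hc | hc
  · convert MeasurableSet.univ
    exact eq_univ_of_forall fun x => hc.trans (fussCatalanDensity_nonneg hr x)
  · have hpos : ∀ x, c ≤ fussCatalanDensity r x → 0 < x := by
      intro x hx
      by_contra! h
      rw [fussCatalanDensity_of_nonpos hr h] at hx
      linarith
    -- Superlevel sets at positive heights are intervals, by antitonicity on `(0, ∞)`.
    refine OrdConnected.measurableSet ⟨fun x hx y hy z hz => ?_⟩
    have hx0 := hpos x hx
    exact le_trans hy (fussCatalanDensity_antitoneOn hr (hx0.trans_le hz.1) (hpos y hy) hz.2)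

/-! ### Moments, uniqueness and unimodality -/

theorem integral_fussCatalanDensity_mul_pow (hr : 1 ≤ r) (k : ℕ) :
    Integrable (fun x => fussCatalanDensity r x * x ^ k) ∧
      ∫ x, fussCatalanDensity r x * x ^ k = fussCatalanNumber (2 * r) r k := by
  have hp : 2 ≤ 2 * r := by linarith
  obtain ⟨hint, hval⟩ := integral_fussCatalanParam_pow hp (by linarith : 0 < r) (by linarith) k
  set S := fussCatalanParam (2 * r) '' Ioo 0 (Real.pi / (2 * r)) with hS
  have hSm : MeasurableSet S := (ordConnected_image_fussCatalanParam hp).measurableSet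
  have hder : ∀ φ ∈ Ioo 0 (Real.pi / (2 * r)), HasDerivWithinAt (fussCatalanParam (2 * r))
      (-(fussCatalanParam (2 * r) φ * fussCatalanLogDeriv (2 * r) φ))
      (Ioo 0 (Real.pi / (2 * r))) φ := fun φ hφ =>
    (hasDerivAt_fussCatalanParam hp hφ).hasDerivWithinAt
  have hinj := (strictAntiOn_fussCatalanParam hp).injOn
  have hzero : ∀ x ∉ S, fussCatalanDensity r x * x ^ k = 0 := fun x hx => by
    rw [fussCatalanDensity_of_notMem hx, zero_mul]
  -- The Jacobian is `ρ` times the logarithmic derivative, and its factor `ρ` turns the angular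
  -- density into `Im (B ^ r) / π`.
  have heq : EqOn (fun φ => |-(fussCatalanParam (2 * r) φ * fussCatalanLogDeriv (2 * r) φ)| •
      (fussCatalanDensity r (fussCatalanParam (2 * r) φ) * fussCatalanParam (2 * r) φ ^ k))
      (fun φ => Real.pi⁻¹ * (fussCatalanLogDeriv (2 * r) φ * (fussCatalanParam (2 * r) φ ^ k *
        ((Real.sin (2 * r * φ) / Real.sin ((2 * r - 1) * φ)) ^ r * Real.sin (r * φ)))))
      (Ioo 0 (Real.pi / (2 * r))) := by
    intro φ hφ
    have hρ := fussCatalanParam_pos hp hφ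
    have hD := fussCatalanLogDeriv_pos hp hφ
    have h := fussCatalanParam_mul_angularDensity hr hφ
    rw [eq_div_iff Real.pi_ne_zero] at h
    simp only [abs_neg, smul_eq_mul]
    rw [abs_of_pos (mul_pos hρ hD), fussCatalanDensity_param hr hφ, ← h]
    field_simp
  constructor
  · rw [← integrableOn_iff_integrable_of_support_subset (s := S)
      (fun x hx => by_contra fun h => hx (hzero x h)),
      integrableOn_image_iff_integrableOn_abs_deriv_smul measurableSet_Ioo hder hinj,
      integrableOn_congr_fun heq measurableSet_Ioo]
    exact hint.const_mul _
  · rw [← setIntegral_eq_integral_of_forall_compl_eq_zero hzero,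
      integral_image_eq_integral_abs_deriv_smul measurableSet_Ioo hder hinj,
      setIntegral_congr_fun measurableSet_Ioo heq, integral_const_mul, hval,
      inv_mul_cancel_left₀ Real.pi_ne_zero]

theorem integral_withDensity_fussCatalanDensity (hr : 1 ≤ r) (g : ℝ → ℝ) :
    ∫ x, g x ∂(volume.withDensity fun x => ENNReal.ofReal (fussCatalanDensity r x)) =
      ∫ x, fussCatalanDensity r x * g x := by
  rw [integral_withDensity_eq_integral_toReal_smul
    (measurable_fussCatalanDensity hr).ennreal_ofReal (by simp)]
  simp [ENNReal.toReal_ofReal (fussCatalanDensity_nonneg hr _)]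

theorem isFussCatalanDistribution_withDensity (hr : 1 ≤ r) :
    IsFussCatalanDistribution (2 * r) r
      (volume.withDensity fun x => ENNReal.ofReal (fussCatalanDensity r x)) := by
  have hI : ∀ k : ℕ, ∫ x, x ^ k ∂(volume.withDensity fun x =>
      ENNReal.ofReal (fussCatalanDensity r x)) = fussCatalanNumber (2 * r) r k := fun k => by
    rw [integral_withDensity_fussCatalanDensity hr, (integral_fussCatalanDensity_mul_pow hr k).2]
  refine ⟨⟨?_⟩, fun k => ?_, hI⟩
  -- The zeroth moment is the real-valued total mass; being `1`, it excludes infinite mass.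
  · have h := hI 0
    simp only [pow_zero, integral_const, smul_eq_mul, mul_one, fussCatalanNumber] at h
    exact (ENNReal.toReal_eq_one_iff _).1 h
  · rw [integrable_withDensity_iff_integrable_smul'
      (measurable_fussCatalanDensity hr).ennreal_ofReal (by simp)]
    simpa [ENNReal.toReal_ofReal (fussCatalanDensity_nonneg hr _)] using
      (integral_fussCatalanDensity_mul_pow hr k).1

theorem IsFussCatalanDistribution.eq_withDensity (hr : 1 ≤ r) {μ : Measure ℝ}
    (hμ : IsFussCatalanDistribution (2 * r) r μ) :
    μ = volume.withDensity fun x => ENNReal.ofReal (fussCatalanDensity r x) := by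
  have hν := isFussCatalanDistribution_withDensity hr
  have := hμ.isProbabilityMeasure
  have := hν.isProbabilityMeasure
  have hp : 2 ≤ 2 * r := by linarith
  obtain ⟨C, hC, hle⟩ := exists_fussCatalanParam_le hp
  refine measure_eq_of_moments_eq hμ.integrable_pow hν.integrable_pow
    (fun k => (hμ.integral_pow k).trans (hν.integral_pow k).symm) hC fun k => ?_
  rw [integral_withDensity_fussCatalanDensity hr]
  obtain ⟨h0int, h0⟩ := integral_fussCatalanDensity_mul_pow hr 0
  -- The density lives on `(0, C]`, so `x ^ (2k)` may be replaced by `C ^ (2k)`.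
  calc ∫ x, fussCatalanDensity r x * x ^ (2 * k)
      ≤ ∫ x, fussCatalanDensity r x * x ^ 0 * C ^ (2 * k) := by
        refine integral_mono (integral_fussCatalanDensity_mul_pow hr _).1
          (h0int.mul_const _) fun x => ?_
        by_cases hx : x ∈ fussCatalanParam (2 * r) '' Ioo 0 (Real.pi / (2 * r))
        · obtain ⟨φ, hφ, rfl⟩ := hx
          have := fussCatalanParam_pos hp hφ
          rw [pow_zero, mul_one]
          exact mul_le_mul_of_nonneg_left (pow_le_pow_left₀ this.le (hle φ hφ) _)
            (fussCatalanDensity_nonneg hr _)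
        · simp [fussCatalanDensity_of_notMem hx]
    _ = C ^ (2 * k) := by
        rw [integral_mul_const, h0]
        simp [fussCatalanNumber]

theorem isUnimodalWithMode_withDensity (hr : 1 ≤ r) :
    IsUnimodalWithMode
      (volume.withDensity fun x => ENNReal.ofReal (fussCatalanDensity r x)) 0 := by
  refine ⟨0, fussCatalanDensity r, fussCatalanDensity_nonneg hr, ?_,
    fussCatalanDensity_antitoneOn hr, by simp⟩
  intro x hx y hy _
  rw [fussCatalanDensity_of_nonpos hr (le_of_lt hx), fussCatalanDensity_of_nonpos hr (le_of_lt hy)]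

end Density

theorem mainTheorem8 (r : ℝ) (hr : 1 ≤ r) :
    (∃! μ : Measure ℝ, IsFussCatalanDistribution (2 * r) r μ) ∧
    ∀ μ : Measure ℝ, IsFussCatalanDistribution (2 * r) r μ →
      IsUnimodal μ ∧
      ∃ W : ℝ → ℝ, Measurable W ∧ (∀ x, 0 ≤ W x) ∧
        μ = volume.withDensity (fun x => ENNReal.ofReal (W x)) ∧
        (∀ x, x ∉ fussCatalanParam (2 * r) '' Ioo 0 (Real.pi / (2 * r)) → W x = 0) ∧
        (∀ φ ∈ Ioo 0 (Real.pi / (2 * r)),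
          W (fussCatalanParam (2 * r) φ) =
            Real.sin ((2 * r - 1) * φ) ^ (r - 1) * Real.sin φ * Real.sin (r * φ) /
              (Real.pi * Real.sin (2 * r * φ) ^ r)) ∧
        MonotoneOn (fun φ => W (fussCatalanParam (2 * r) φ)) (Ioo 0 (Real.pi / (2 * r))) := by
  refine ⟨⟨_, isFussCatalanDistribution_withDensity hr, fun μ hμ => hμ.eq_withDensity hr⟩, ?_⟩
  intro μ hμ
  rw [hμ.eq_withDensity hr]
  refine ⟨⟨0, isUnimodalWithMode_withDensity hr⟩, fussCatalanDensity r,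
    measurable_fussCatalanDensity hr, fussCatalanDensity_nonneg hr, rfl,
    fun x hx => fussCatalanDensity_of_notMem hx, fun φ hφ => fussCatalanDensity_param hr hφ, ?_⟩
  exact (fussCatalanAngularDensity_monotoneOn hr).congr
    fun φ hφ => (fussCatalanDensity_param hr hφ).symm
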